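/- There is a function $C:\mathbb{R}\to\mathbb{R}$ such that the following holds. Let $0<x_0\le \pi/2$ and $x_n=\sin(x_{n-1})$ for $n\ge 1$, and write $C=C(x_0)$. Then, as $n\to\infty$, \begin{align*} \frac{x_n}{\sqrt3} ={}& \frac1{n^{1/2}}-\frac3{10}\frac{\ln n}{n^{3/2}}-\frac C2\frac1{n^{3/2}}+\frac{27}{200}\frac{(\ln n)^2}{n^{5/2}}+\left(\frac9{20}C-\frac9{50}\right)\frac{\ln n}{n^{5/2}}+\left(\frac38C^2-\frac3{10}C+\frac{79}{700}\right)\frac1{n^{5/2}}\\ &-\frac{27}{400}\frac{(\ln n)^3}{n^{7/2}}-\left(\frac{27}{80}C-\frac{27}{125}\right)\frac{(\ln n)^2}{n^{7/2}}-\left(\frac9{16}C^2-\frac{18}{25}C+\frac{1941}{7000}\right)\frac{\ln n}{n^{7/2}}\\ &-\left(\frac5{16}C^3-\frac35C^2+\frac{647}{1400}C-\frac{411}{3500}\right)\frac1{n^{7/2}}\\ &+\frac{567}{16000}\frac{(\ln n)^4}{n^{9/2}}+\left(\frac{189}{800}C-\frac{1917}{10000}\right)\frac{(\ln n)^3}{n^{9/2}}+\left(\frac{189}{320}C^2-\frac{1917}{2000}C+\frac{1683}{4000}\right)\frac{(\ln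 n)^2}{n^{9/2}}\\ &+\left(\frac{21}{32}C^3-\frac{639}{400}C^2+\frac{561}{400}C-\frac{7227}{17500}\right)\frac{\ln n}{n^{9/2}}\\ &+\left(\frac{35}{128}C^4-\frac{71}{80}C^3+\frac{187}{160}C^2-\frac{2409}{3500}C+\frac{1606257}{10780000}\right)\frac1{n^{9/2}}+O\!\left(\frac{(\ln n)^5}{n^{11/2}}\right), \end{align*} where the implied constant may depend on $x_0$. -/

import Mathlib

open Filter Asymptotics

noncomputable section

/-- The explicit expansion, through order `n ^ (-9/2)`, of the `n`-th iterate of the sine divided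
by `√3`, with free constant `C`. -/
def sineExpansion (C : ℝ) (n : ℕ) : ℝ :=
  1 / (n : ℝ) ^ (1 / 2 : ℝ)
  - 3 / 10 * (Real.log n / (n : ℝ) ^ (3 / 2 : ℝ))
  - C / 2 * (1 / (n : ℝ) ^ (3 / 2 : ℝ))
  + 27 / 200 * (Real.log n ^ 2 / (n : ℝ) ^ (5 / 2 : ℝ))
  + (9 / 20 * C - 9 / 50) * (Real.log n / (n : ℝ) ^ (5 / 2 : ℝ))
  + (3 / 8 * C ^ 2 - 3 / 10 * C + 79 / 700) * (1 / (n : ℝ) ^ (5 / 2 : ℝ))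
  - 27 / 400 * (Real.log n ^ 3 / (n : ℝ) ^ (7 / 2 : ℝ))
  - (27 / 80 * C - 27 / 125) * (Real.log n ^ 2 / (n : ℝ) ^ (7 / 2 : ℝ))
  - (9 / 16 * C ^ 2 - 18 / 25 * C + 1941 / 7000) * (Real.log n / (n : ℝ) ^ (7 / 2 : ℝ))
  - (5 / 16 * C ^ 3 - 3 / 5 * C ^ 2 + 647 / 1400 * C - 411 / 3500)
      * (1 / (n : ℝ) ^ (7 / 2 : ℝ))
  + 567 / 16000 * (Real.log n ^ 4 / (n : ℝ) ^ (9 / 2 : ℝ))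
  + (189 / 800 * C - 1917 / 10000) * (Real.log n ^ 3 / (n : ℝ) ^ (9 / 2 : ℝ))
  + (189 / 320 * C ^ 2 - 1917 / 2000 * C + 1683 / 4000)
      * (Real.log n ^ 2 / (n : ℝ) ^ (9 / 2 : ℝ))
  + (21 / 32 * C ^ 3 - 639 / 400 * C ^ 2 + 561 / 400 * C - 7227 / 17500)
      * (Real.log n / (n : ℝ) ^ (9 / 2 : ℝ))
  + (35 / 128 * C ^ 4 - 71 / 80 * C ^ 3 + 187 / 160 * C ^ 2 - 2409 / 3500 * C
      + 1606257 / 10780000) * (1 / (n : ℝ) ^ (9 / 2 : ℝ))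

end

/-!
The proof rests on an approximate Abel function for the sine. Write `s = x / √3` and
`Ψ s = 1 / s ^ 2 + 6 / 5 * log s + a₁ s ^ 2 + a₂ s ^ 4 + a₃ s ^ 6` (`abelFun`). The leading terms
come from `1 / sin x ^ 2 = 1 / x ^ 2 + 1 / 3 + x ^ 2 / 15 + ⋯`, and the `aᵢ` are the unique
rational numbers for which `x ↦ sin x` raises `Ψ` by `1 + O(x ^ 10)`
(`abelFun_sin_sub_isBigO`).

Along the iterates `xₙ` the increments of `Ψ` tend to `1`, so by Cesàro `n * xₙ ^ 2 / 3 → 1`. Hence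
the increments differ from `1` by `O(n ^ (-5))`, and summation gives a constant `c` with
`Ψ (xₙ / √3) = n + c + O(n ^ (-4))` (`exists_abelFun_sin_iterate`). This `c` is the constant of the
expansion.

It remains to invert `Ψ`. After the substitution `s = w / √n` the function `Ψ / n` becomes, up to a
term in `log n / n`, the function `scaledAbel (1 / n) w`, which is smooth near `(0, 1)` with
derivative `-2` in `w`. The proposed expansion, multiplied by `√n`, is a polynomial in
`t = log n / n` and `1 / n = r t`, where `r = 1 / log n`; substituting it into `scaledAbel` and
comparing coefficients up to `t ^ 4` shows that it solves the same equation up to `O(t ^ 5)`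
(`scaledAbel_series_isBigO`). Since the derivative in `w` does not vanish, approximate solutions
are close to each other (`sub_isBigO_scaledAbel_sub`).

Both coefficient comparisons, for `sin x / x` and for the logarithmic series, are instances of one
expansion of `scaledAbel` along a curve with bounded coefficients (`scaledAbel_expansion`).
-/

open Topology

/-! ### An approximate Abel function for the sine -/

/-- The approximate Abel function, in the variable `s = x / √3`: the substitution `x ↦ sin x`
increases it by `1 + O(x ^ 10)`. -/
noncomputable def abelFun (s : ℝ) : ℝ :=
  1 / s ^ 2 + 6 / 5 * Real.log s + 79 / 350 * s ^ 2 + 87 / 875 * s ^ 4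
    + 91543 / 1347500 * s ^ 6

/-- The rescaled Abel function: up to the summand `6 / 5 * q ^ 2 * log q`, this is
`q ^ 2 * abelFun (q * w)` for `v = q ^ 2`. -/
noncomputable def scaledAbel (v w : ℝ) : ℝ :=
  1 / w ^ 2 + 6 / 5 * v * Real.log w + 79 / 350 * v ^ 2 * w ^ 2 + 87 / 875 * v ^ 3 * w ^ 4
    + 91543 / 1347500 * v ^ 4 * w ^ 6

/-- Scaling: with `q = x / √3` and `w = sin x / x` this compares `x` with `sin x`; with
`q = n ^ (-1/2)` it puts the iterates into the scale in which they converge. -/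
lemma sq_mul_abelFun_mul {q w : ℝ} (hq : 0 < q) (hw : 0 < w) :
    q ^ 2 * abelFun (q * w) = scaledAbel (q ^ 2) w + 6 / 5 * q ^ 2 * Real.log q := by
  unfold abelFun scaledAbel
  rw [Real.log_mul hq.ne' hw.ne']
  field_simp
  ring

/-! ### Expansion of the rescaled Abel function -/

/-- A continuous function of bounded functions is bounded. -/
lemma Continuous.comp_isBigO_one {α X : Type*} [SeminormedAddCommGroup X] [ProperSpace X]
    {l : Filter α} {R : X → ℝ} (hR : Continuous R) {e : α → X}
    (he : e =O[l] (fun _ => (1 : ℝ))) :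
    (fun a => R (e a)) =O[l] (fun _ => (1 : ℝ)) := by
  obtain ⟨M, hM⟩ := he.bound
  obtain ⟨K, hK⟩ := (isCompact_closedBall (0 : X) M).exists_bound_of_continuousOn hR.continuousOn
  refine IsBigO.of_bound K ?_
  filter_upwards [hM] with a ha
  simpa using hK (e a) (by simpa using ha)

/-- The inverse square along a vanishing function, to sixth order. -/
lemma one_div_one_add_sq_expansion {α : Type*} {l : Filter α} {E t : α → ℝ}
    (hE : E =O[l] t) (ht : Tendsto t l (𝓝 0)) :
    (fun a => 1 / (1 + E a) ^ 2
      - (1 - 2 * E a + 3 * E a ^ 2 - 4 * E a ^ 3 + 5 * E a ^ 4 - 6 * E a ^ 5))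
      =O[l] (fun a => t a ^ 6) := by
  have hE0 : Tendsto E l (𝓝 0) := hE.trans_tendsto ht
  have hlim : Tendsto (fun a => (7 + 6 * E a) / (1 + E a) ^ 2) l (𝓝 ((7 + 6 * 0) / (1 + 0) ^ 2)) :=
    ((hE0.const_mul 6).const_add 7).div ((hE0.const_add 1).pow 2) (by norm_num)
  have := (hE.pow 6).mul (hlim.isBigO_one ℝ)
  simp only [mul_one] at this
  refine this.congr' ?_ EventuallyEq.rfl
  filter_upwards [hE0.eventually_ne (show (0 : ℝ) ≠ -1 by norm_num)] with a ha
  have : 1 + E a ≠ 0 := fun h => ha (by linarith)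
  field_simp
  ring

/-- The logarithm along a vanishing function, to fifth order. -/
lemma log_one_add_expansion {α : Type*} {l : Filter α} {E t : α → ℝ}
    (hE : E =O[l] t) (ht : Tendsto t l (𝓝 0)) :
    (fun a => Real.log (1 + E a) - (E a - E a ^ 2 / 2 + E a ^ 3 / 3 - E a ^ 4 / 4))
      =O[l] (fun a => t a ^ 5) := by
  have hE0 : Tendsto E l (𝓝 0) := hE.trans_tendsto ht
  refine IsBigO.trans (IsBigO.of_bound 2 ?_) (hE.pow 5)
  have h0 : |(0 : ℝ)| < 1 / 2 := by norm_num
  filter_upwards [hE0.abs.eventually_le_const h0] with a ha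
  have h := Real.abs_log_sub_add_sum_range_le (x := -E a) (by rw [abs_neg]; linarith) 4
  rw [abs_neg, sub_neg_eq_add, add_comm] at h
  simp only [Finset.sum_range_succ, Finset.sum_range_zero] at h
  rw [Real.norm_eq_abs, Real.norm_eq_abs, abs_pow]
  calc _ = _ := by congr 1; push_cast; ring
    _ ≤ _ := h
    _ ≤ |E a| ^ 5 / (1 / 2) := by gcongr; linarith
    _ = 2 * |E a| ^ 5 := by ring

/-- The polynomial part of `scaledAbel (r t) (1 + E)`, truncated at order `t ^ 6`. The `kᵢ` are the
successive tails of `E = e₁ t + e₂ t ^ 2 + ⋯`; the remainder is an explicit polynomial in them. -/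
lemma scaledAbel_truncation {t r e₁ e₂ e₃ e₄ e₅ k k₀ k₁ k₂ k₃ k₄ E : ℝ}
    (h₄ : k₄ = e₅ + k * t) (h₃ : k₃ = e₄ + k₄ * t) (h₂ : k₂ = e₃ + k₃ * t)
    (h₁ : k₁ = e₂ + k₂ * t) (h₀ : k₀ = e₁ + k₁ * t) (hE : E = k₀ * t) :
    (1 - 2 * E + 3 * E ^ 2 - 4 * E ^ 3 + 5 * E ^ 4 - 6 * E ^ 5)
      + 6 / 5 * (r * t) * (E - E ^ 2 / 2 + E ^ 3 / 3 - E ^ 4 / 4)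
      + 79 / 350 * (r * t) ^ 2 * (1 + E) ^ 2 + 87 / 875 * (r * t) ^ 3 * (1 + E) ^ 4
      + 91543 / 1347500 * (r * t) ^ 4 * (1 + E) ^ 6
      - (1 - 2 * e₁ * t
        + (-2 * e₂ + 3 * e₁ ^ 2 + 6 / 5 * r * e₁ + 79 / 350 * r ^ 2) * t ^ 2
        + (-2 * e₃ + 6 * e₁ * e₂ - 4 * e₁ ^ 3 + 6 / 5 * r * (e₂ - e₁ ^ 2 / 2)
          + 79 / 350 * r ^ 2 * (2 * e₁) + 87 / 875 * r ^ 3) * t ^ 3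
        + (-2 * e₄ + 6 * e₁ * e₃ + 3 * e₂ ^ 2 - 12 * e₁ ^ 2 * e₂ + 5 * e₁ ^ 4
          + 6 / 5 * r * (e₃ - e₁ * e₂ + e₁ ^ 3 / 3)
          + 79 / 350 * r ^ 2 * (2 * e₂ + e₁ ^ 2) + 87 / 875 * r ^ 3 * (4 * e₁)
          + 91543 / 1347500 * r ^ 4) * t ^ 4
        + (-2 * e₅ + 6 * e₁ * e₄ + 6 * e₂ * e₃ - 12 * e₁ ^ 2 * e₃
          - 12 * e₁ * e₂ ^ 2 + 20 * e₁ ^ 3 * e₂ - 6 * e₁ ^ 5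
          + 6 / 5 * r * (e₄ - e₁ * e₃ - e₂ ^ 2 / 2 + e₁ ^ 2 * e₂ - e₁ ^ 4 / 4)
          + 79 / 350 * r ^ 2 * (2 * e₃ + 2 * e₁ * e₂)
          + 87 / 875 * r ^ 3 * (4 * e₂ + 6 * e₁ ^ 2)
          + 91543 / 1347500 * r ^ 4 * (6 * e₁)) * t ^ 5) = t ^ 6 *
      (-2 * k + 3 * (2 * e₁ * k₄ + 2 * e₂ * k₃ + k₂ ^ 2)
        - 4 * (3 * e₁ ^ 2 * k₃ + 3 * e₁ * (2 * e₂ * k₂ + k₂ ^ 2 * t) + k₁ ^ 3)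
        + 5 * (4 * e₁ ^ 3 * k₂ + 6 * e₁ ^ 2 * k₁ ^ 2 + 4 * e₁ * k₁ ^ 3 * t + k₁ ^ 4 * t ^ 2)
        - 6 * (5 * e₁ ^ 4 * k₁ + 10 * e₁ ^ 3 * k₁ ^ 2 * t + 10 * e₁ ^ 2 * k₁ ^ 3 * t ^ 2
          + 5 * e₁ * k₁ ^ 4 * t ^ 3 + k₁ ^ 5 * t ^ 4)
        + 6 / 5 * r * (k₄ - (2 * e₁ * k₃ + 2 * e₂ * k₂ + k₂ ^ 2 * t) / 2
          + (3 * e₁ ^ 2 * k₂ + 3 * e₁ * k₁ ^ 2 + k₁ ^ 3 * t) / 3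
          - (4 * e₁ ^ 3 * k₁ + 6 * e₁ ^ 2 * k₁ ^ 2 * t + 4 * e₁ * k₁ ^ 3 * t ^ 2
            + k₁ ^ 4 * t ^ 3) / 4)
        + 79 / 350 * r ^ 2 * (2 * k₃ + (2 * e₁ * k₂ + k₁ ^ 2))
        + 87 / 875 * r ^ 3 * (4 * k₂ + 6 * (2 * e₁ * k₁ + k₁ ^ 2 * t) + 4 * k₀ ^ 3 + k₀ ^ 4 * t)
        + 91543 / 1347500 * r ^ 4 * (6 * k₁ + 15 * k₀ ^ 2 + 20 * k₀ ^ 3 * t + 15 * k₀ ^ 4 * t ^ 2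
          + 6 * k₀ ^ 5 * t ^ 3 + k₀ ^ 6 * t ^ 4)) := by
  have q1 : E = e₁ * t + e₂ * t ^ 2 + e₃ * t ^ 3 + e₄ * t ^ 4 + e₅ * t ^ 5 + k * t ^ 6 := by
    subst_vars; ring
  have q2 : E ^ 2 = e₁ ^ 2 * t ^ 2 + 2 * e₁ * e₂ * t ^ 3 + (2 * e₁ * e₃ + e₂ ^ 2) * t ^ 4
      + (2 * e₁ * e₄ + 2 * e₂ * e₃) * t ^ 5
      + (2 * e₁ * k₄ + 2 * e₂ * k₃ + k₂ ^ 2) * t ^ 6 := by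
    rw [hE, h₀, h₁, h₂, h₃]; ring
  have q3 : E ^ 3 = e₁ ^ 3 * t ^ 3 + 3 * e₁ ^ 2 * e₂ * t ^ 4
      + (3 * e₁ ^ 2 * e₃ + 3 * e₁ * e₂ ^ 2) * t ^ 5
      + (3 * e₁ ^ 2 * k₃ + 3 * e₁ * (2 * e₂ * k₂ + k₂ ^ 2 * t) + k₁ ^ 3) * t ^ 6 := by
    rw [hE, h₀, h₁, h₂]; ring
  have q4 : E ^ 4 = e₁ ^ 4 * t ^ 4 + 4 * e₁ ^ 3 * e₂ * t ^ 5
      + (4 * e₁ ^ 3 * k₂ + 6 * e₁ ^ 2 * k₁ ^ 2 + 4 * e₁ * k₁ ^ 3 * t + k₁ ^ 4 * t ^ 2)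
        * t ^ 6 := by
    rw [hE, h₀, h₁]; ring
  have q5 : E ^ 5 = e₁ ^ 5 * t ^ 5
      + (5 * e₁ ^ 4 * k₁ + 10 * e₁ ^ 3 * k₁ ^ 2 * t + 10 * e₁ ^ 2 * k₁ ^ 3 * t ^ 2
          + 5 * e₁ * k₁ ^ 4 * t ^ 3 + k₁ ^ 5 * t ^ 4) * t ^ 6 := by
    rw [hE, h₀]; ring
  have l1 : E = e₁ * t + e₂ * t ^ 2 + e₃ * t ^ 3 + e₄ * t ^ 4 + k₄ * t ^ 5 := by
    rw [hE, h₀, h₁, h₂, h₃]; ring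
  have l2 : E ^ 2 = e₁ ^ 2 * t ^ 2 + 2 * e₁ * e₂ * t ^ 3 + (2 * e₁ * e₃ + e₂ ^ 2) * t ^ 4
      + (2 * e₁ * k₃ + 2 * e₂ * k₂ + k₂ ^ 2 * t) * t ^ 5 := by
    rw [hE, h₀, h₁, h₂]; ring
  have l3 : E ^ 3 = e₁ ^ 3 * t ^ 3 + 3 * e₁ ^ 2 * e₂ * t ^ 4
      + (3 * e₁ ^ 2 * k₂ + 3 * e₁ * k₁ ^ 2 + k₁ ^ 3 * t) * t ^ 5 := by
    rw [hE, h₀, h₁]; ring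
  have l4 : E ^ 4 = e₁ ^ 4 * t ^ 4
      + (4 * e₁ ^ 3 * k₁ + 6 * e₁ ^ 2 * k₁ ^ 2 * t + 4 * e₁ * k₁ ^ 3 * t ^ 2 + k₁ ^ 4 * t ^ 3)
        * t ^ 5 := by
    rw [hE, h₀]; ring
  have s2 : (1 + E) ^ 2 = 1 + 2 * e₁ * t + (2 * e₂ + e₁ ^ 2) * t ^ 2
      + (2 * e₃ + 2 * e₁ * e₂) * t ^ 3 + (2 * k₃ + (2 * e₁ * k₂ + k₁ ^ 2)) * t ^ 4 := by
    rw [hE, h₀, h₁, h₂]; ring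
  have s4 : (1 + E) ^ 4 = 1 + 4 * e₁ * t + (4 * e₂ + 6 * e₁ ^ 2) * t ^ 2
      + (4 * k₂ + 6 * (2 * e₁ * k₁ + k₁ ^ 2 * t) + 4 * k₀ ^ 3 + k₀ ^ 4 * t) * t ^ 3 := by
    have : (1 + E) ^ 4 = 1 + 4 * (k₀ * t) + 6 * (k₀ * t) ^ 2
      + (4 * k₀ ^ 3 + k₀ ^ 4 * t) * t ^ 3 := by rw [hE]; ring
    rw [this, h₀, h₁]; ring
  have s6 : (1 + E) ^ 6 = 1 + 6 * e₁ * t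
      + (6 * k₁ + 15 * k₀ ^ 2 + 20 * k₀ ^ 3 * t + 15 * k₀ ^ 4 * t ^ 2
          + 6 * k₀ ^ 5 * t ^ 3 + k₀ ^ 6 * t ^ 4) * t ^ 2 := by
    have : (1 + E) ^ 6 = 1 + 6 * (k₀ * t) + (15 * k₀ ^ 2 + 20 * k₀ ^ 3 * t
      + 15 * k₀ ^ 4 * t ^ 2 + 6 * k₀ ^ 5 * t ^ 3 + k₀ ^ 6 * t ^ 4) * t ^ 2 := by rw [hE]; ring
    rw [this, h₀]; ring
  -- Each power of `E` is truncated just as far as its coefficient requires.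
  linear_combination -2 * q1 + 3 * q2 - 4 * q3 + 5 * q4 - 6 * q5
    + 6 / 5 * (r * t) * (l1 - l2 / 2 + l3 / 3 - l4 / 4)
    + 79 / 350 * (r * t) ^ 2 * s2 + 87 / 875 * (r * t) ^ 3 * s4
    + 91543 / 1347500 * (r * t) ^ 4 * s6

/-- The expansion of `scaledAbel` along a curve `(v, w) = (r t, 1 + e₁ t + ⋯ + e₅ t ^ 5 + k t ^ 6)`
whose coefficients may themselves vary, as long as they stay bounded. -/
lemma scaledAbel_expansion {α : Type*} {l : Filter α} {t r e₁ e₂ e₃ e₄ e₅ k : α → ℝ}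
    (ht : Tendsto t l (𝓝 0)) (hr : r =O[l] (fun _ => (1 : ℝ)))
    (h₁ : e₁ =O[l] (fun _ => (1 : ℝ))) (h₂ : e₂ =O[l] (fun _ => (1 : ℝ)))
    (h₃ : e₃ =O[l] (fun _ => (1 : ℝ))) (h₄ : e₄ =O[l] (fun _ => (1 : ℝ)))
    (h₅ : e₅ =O[l] (fun _ => (1 : ℝ))) (hk : k =O[l] (fun _ => (1 : ℝ))) :
    (fun a => scaledAbel (r a * t a) (1 + (e₁ a * t a + e₂ a * t a ^ 2 + e₃ a * t a ^ 3
        + e₄ a * t a ^ 4 + e₅ a * t a ^ 5 + k a * t a ^ 6))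
      - (1 - 2 * e₁ a * t a
        + (-2 * e₂ a + 3 * e₁ a ^ 2 + 6 / 5 * r a * e₁ a + 79 / 350 * r a ^ 2) * t a ^ 2
        + (-2 * e₃ a + 6 * e₁ a * e₂ a - 4 * e₁ a ^ 3 + 6 / 5 * r a * (e₂ a - e₁ a ^ 2 / 2)
          + 79 / 350 * r a ^ 2 * (2 * e₁ a) + 87 / 875 * r a ^ 3) * t a ^ 3
        + (-2 * e₄ a + 6 * e₁ a * e₃ a + 3 * e₂ a ^ 2 - 12 * e₁ a ^ 2 * e₂ a + 5 * e₁ a ^ 4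
          + 6 / 5 * r a * (e₃ a - e₁ a * e₂ a + e₁ a ^ 3 / 3)
          + 79 / 350 * r a ^ 2 * (2 * e₂ a + e₁ a ^ 2) + 87 / 875 * r a ^ 3 * (4 * e₁ a)
          + 91543 / 1347500 * r a ^ 4) * t a ^ 4
        + (-2 * e₅ a + 6 * e₁ a * e₄ a + 6 * e₂ a * e₃ a - 12 * e₁ a ^ 2 * e₃ a
          - 12 * e₁ a * e₂ a ^ 2 + 20 * e₁ a ^ 3 * e₂ a - 6 * e₁ a ^ 5
          + 6 / 5 * r a * (e₄ a - e₁ a * e₃ a - e₂ a ^ 2 / 2 + e₁ a ^ 2 * e₂ a - e₁ a ^ 4 / 4)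
          + 79 / 350 * r a ^ 2 * (2 * e₃ a + 2 * e₁ a * e₂ a)
          + 87 / 875 * r a ^ 3 * (4 * e₂ a + 6 * e₁ a ^ 2)
          + 91543 / 1347500 * r a ^ 4 * (6 * e₁ a)) * t a ^ 5))
      =O[l] (fun a => t a ^ 6) := by
  have ht1 : t =O[l] (fun _ => (1 : ℝ)) := ht.isBigO_one ℝ
  have step {f g : α → ℝ} (hf : f =O[l] (fun _ => (1 : ℝ))) (hg : g =O[l] (fun _ => (1 : ℝ))) :
      (fun a => f a + g a * t a) =O[l] (fun _ => (1 : ℝ)) := hf.add (by simpa using hg.mul ht1)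
  -- The successive tails `kᵢ` of the series, all bounded.
  obtain ⟨k₄, b₄, q₄⟩ : ∃ f : α → ℝ, f =O[l] (fun _ => (1 : ℝ)) ∧ ∀ a, f a = e₅ a + k a * t a :=
    ⟨_, step h₅ hk, fun _ => rfl⟩
  obtain ⟨k₃, b₃, q₃⟩ : ∃ f : α → ℝ, f =O[l] (fun _ => (1 : ℝ)) ∧ ∀ a, f a = e₄ a + k₄ a * t a :=
    ⟨_, step h₄ b₄, fun _ => rfl⟩
  obtain ⟨k₂, b₂, q₂⟩ : ∃ f : α → ℝ, f =O[l] (fun _ => (1 : ℝ)) ∧ ∀ a, f a = e₃ a + k₃ a * t a :=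
    ⟨_, step h₃ b₃, fun _ => rfl⟩
  obtain ⟨k₁, b₁, q₁⟩ : ∃ f : α → ℝ, f =O[l] (fun _ => (1 : ℝ)) ∧ ∀ a, f a = e₂ a + k₂ a * t a :=
    ⟨_, step h₂ b₂, fun _ => rfl⟩
  obtain ⟨k₀, b₀, q₀⟩ : ∃ f : α → ℝ, f =O[l] (fun _ => (1 : ℝ)) ∧ ∀ a, f a = e₁ a + k₁ a * t a :=
    ⟨_, step h₁ b₁, fun _ => rfl⟩
  obtain ⟨E, hE, qE⟩ : ∃ f : α → ℝ, f =O[l] t ∧ ∀ a, f a = k₀ a * t a :=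
    ⟨_, by simpa using b₀.mul (isBigO_refl t l), fun _ => rfl⟩
  have hlog : (fun a => 6 / 5 * (r a * t a) * (Real.log (1 + E a)
      - (E a - E a ^ 2 / 2 + E a ^ 3 / 3 - E a ^ 4 / 4))) =O[l] (fun a => t a ^ 6) :=
    (((hr.mul (isBigO_refl t l)).const_mul_left (6 / 5)).mul
      (log_one_add_expansion hE ht)).congr_right fun a => by ring
  have hpO : (fun a => ![t a, r a, e₁ a, e₂ a, k₀ a, k₁ a, k₂ a, k₃ a, k₄ a, k a])
      =O[l] (fun _ => (1 : ℝ)) := by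
    rw [isBigO_pi]
    intro i
    fin_cases i <;> assumption
  have hR : Continuous fun x : Fin 10 → ℝ =>
      (-2 * x 9 + 3 * (2 * x 2 * x 8 + 2 * x 3 * x 7 + x 6 ^ 2)
        - 4 * (3 * x 2 ^ 2 * x 7 + 3 * x 2 * (2 * x 3 * x 6 + x 6 ^ 2 * x 0) + x 5 ^ 3)
        + 5 * (4 * x 2 ^ 3 * x 6 + 6 * x 2 ^ 2 * x 5 ^ 2 + 4 * x 2 * x 5 ^ 3 * x 0
          + x 5 ^ 4 * x 0 ^ 2)
        - 6 * (5 * x 2 ^ 4 * x 5 + 10 * x 2 ^ 3 * x 5 ^ 2 * x 0 + 10 * x 2 ^ 2 * x 5 ^ 3 * x 0 ^ 2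
          + 5 * x 2 * x 5 ^ 4 * x 0 ^ 3 + x 5 ^ 5 * x 0 ^ 4)
        + 6 / 5 * x 1 * (x 8 - (2 * x 2 * x 7 + 2 * x 3 * x 6 + x 6 ^ 2 * x 0) / 2
          + (3 * x 2 ^ 2 * x 6 + 3 * x 2 * x 5 ^ 2 + x 5 ^ 3 * x 0) / 3
          - (4 * x 2 ^ 3 * x 5 + 6 * x 2 ^ 2 * x 5 ^ 2 * x 0 + 4 * x 2 * x 5 ^ 3 * x 0 ^ 2
            + x 5 ^ 4 * x 0 ^ 3) / 4)
        + 79 / 350 * x 1 ^ 2 * (2 * x 7 + (2 * x 2 * x 6 + x 5 ^ 2))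
        + 87 / 875 * x 1 ^ 3 * (4 * x 6 + 6 * (2 * x 2 * x 5 + x 5 ^ 2 * x 0) + 4 * x 4 ^ 3
          + x 4 ^ 4 * x 0)
        + 91543 / 1347500 * x 1 ^ 4 * (6 * x 5 + 15 * x 4 ^ 2 + 20 * x 4 ^ 3 * x 0
          + 15 * x 4 ^ 4 * x 0 ^ 2 + 6 * x 4 ^ 5 * x 0 ^ 3 + x 4 ^ 6 * x 0 ^ 4)) := by
    fun_prop
  have hpoly := (isBigO_refl (fun a => t a ^ 6) l).mul (hR.comp_isBigO_one hpO)
  simp only [mul_one] at hpoly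
  refine (((one_div_one_add_sq_expansion hE ht).add hlog).add hpoly).congr_left fun a => ?_
  have hEa : e₁ a * t a + e₂ a * t a ^ 2 + e₃ a * t a ^ 3 + e₄ a * t a ^ 4 + e₅ a * t a ^ 5
      + k a * t a ^ 6 = E a := by
    rw [qE, q₀, q₁, q₂, q₃, q₄]; ring
  rw [hEa]
  have key := scaledAbel_truncation (r := r a) (q₄ a) (q₃ a) (q₂ a) (q₁ a) (q₀ a) (qE a)
  unfold scaledAbel
  refine Eq.trans (congrArg (fun z => _ + z) key.symm) ?_
  ring

/-! ### Taylor expansion of the sine and the increment of the Abel function -/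

lemma sin_sub_taylor_isBigO :
    (fun x : ℝ => Real.sin x - (x - x ^ 3 / 6 + x ^ 5 / 120 - x ^ 7 / 5040 + x ^ 9 / 362880
      - x ^ 11 / 39916800)) =O[𝓝 0] (fun x => x ^ 13) := by
  have hlim : Tendsto (fun x : ℝ => (x : ℂ) * Complex.I) (𝓝 0) (𝓝 0) := by
    have : Continuous fun x : ℝ => (x : ℂ) * Complex.I := by fun_prop
    simpa using this.tendsto 0
  have h := (Complex.exp_sub_sum_range_isBigO_pow 13).comp_tendsto hlim
  have h2 : (fun x : ℝ => Real.sin x - (x - x ^ 3 / 6 + x ^ 5 / 120 - x ^ 7 / 5040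
      + x ^ 9 / 362880 - x ^ 11 / 39916800)) =O[𝓝 0]
      ((fun z : ℂ => Complex.exp z - ∑ i ∈ Finset.range 13, z ^ i / (i.factorial : ℂ)) ∘
        fun x : ℝ => (x : ℂ) * Complex.I) := by
    refine IsBigO.of_bound 1 (Eventually.of_forall fun x => ?_)
    rw [one_mul, Real.norm_eq_abs]
    refine le_trans (le_of_eq ?_) (Complex.abs_im_le_norm _)
    congr 1
    -- The sine and its Taylor polynomial are imaginary parts of `exp (x I)` and its partial sum.
    have hI3 : Complex.I ^ 3 = -Complex.I := by rw [pow_succ, Complex.I_sq]; ring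
    have hI (n : ℕ) : Complex.I ^ (n + 4) = Complex.I ^ n := by
      rw [pow_add, Complex.I_pow_four, mul_one]
    have hre : Complex.exp (x * Complex.I) - ∑ i ∈ Finset.range 13,
        ((x : ℂ) * Complex.I) ^ i / (i.factorial : ℂ)
        = ((Real.cos x - (1 - x ^ 2 / 2 + x ^ 4 / 24 - x ^ 6 / 720 + x ^ 8 / 40320
          - x ^ 10 / 3628800 + x ^ 12 / 479001600) : ℝ) : ℂ)
          + ((Real.sin x - (x - x ^ 3 / 6 + x ^ 5 / 120 - x ^ 7 / 5040 + x ^ 9 / 362880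
          - x ^ 11 / 39916800) : ℝ) : ℂ) * Complex.I := by
      rw [Complex.exp_mul_I]
      simp only [Finset.sum_range_succ, Finset.sum_range_zero, mul_pow, hI, hI3, Complex.I_sq,
        pow_zero, pow_one, Nat.factorial]
      push_cast
      ring
    simp only [Function.comp_apply]
    rw [hre, Complex.add_im, Complex.ofReal_im, Complex.im_ofReal_mul, Complex.I_im, zero_add,
      mul_one]
  refine (h2.trans h).trans (IsBigO.of_bound 1 (Eventually.of_forall fun x => ?_))
  simp [mul_pow]

/-- The step `x ↦ sin x` raises the Abel function by almost exactly one. -/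
lemma abelFun_sin_sub_isBigO :
    (fun x : ℝ => abelFun (Real.sin x / √3) - abelFun (x / √3) - 1)
      =O[𝓝[>] 0] (fun x => x ^ 10) := by
  have hpos : ∀ᶠ x : ℝ in 𝓝[>] 0, 0 < x := eventually_mem_nhdsWithin
  have ht : Tendsto (fun x : ℝ => x ^ 2 / 3) (𝓝[>] 0) (𝓝 0) := by
    have : Continuous fun x : ℝ => x ^ 2 / 3 := by fun_prop
    simpa using (this.tendsto 0).mono_left nhdsWithin_le_nhds
  have hconst (c : ℝ) : (fun _ : ℝ => c) =O[𝓝[>] (0 : ℝ)] (fun _ => (1 : ℝ)) :=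
    isBigO_const_const _ one_ne_zero _
  -- The Taylor coefficients of `sin x / x` in powers of `t = x ^ 2 / 3`, and the remainder;
  -- the factor is `729 / x ^ 13 = 1 / (x * t ^ 6)`.
  have hk : (fun x : ℝ => (Real.sin x - (x - x ^ 3 / 6 + x ^ 5 / 120 - x ^ 7 / 5040
      + x ^ 9 / 362880 - x ^ 11 / 39916800)) * (729 / x ^ 13)) =O[𝓝[>] 0] (fun _ => (1 : ℝ)) := by
    have := (sin_sub_taylor_isBigO.mono nhdsWithin_le_nhds).mul
      (isBigO_refl (fun x : ℝ => 729 / x ^ 13) (𝓝[>] 0))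
    refine this.trans ((hconst 729).congr' ?_ EventuallyEq.rfl)
    filter_upwards [hpos] with x hx
    field_simp
  have key := scaledAbel_expansion ht (hconst 1) (hconst (-1 / 2)) (hconst (3 / 40))
    (hconst (-3 / 560)) (hconst (1 / 4480)) (hconst (-27 / 4435200)) hk
  have h := key.mul (isBigO_refl (fun x : ℝ => 3 / x ^ 2) (𝓝[>] 0))
  refine (h.congr' ?_ EventuallyEq.rfl).trans ?_
  · filter_upwards [hpos, (nhdsWithin_le_nhds (Iio_mem_nhds Real.pi_pos) :
      ∀ᶠ x : ℝ in 𝓝[>] 0, x < Real.pi)] with x hx hxpi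
    have hs : 0 < Real.sin x := Real.sin_pos_of_pos_of_lt_pi hx hxpi
    have hq : 0 < x / √3 := by positivity
    have e1 := sq_mul_abelFun_mul hq (show 0 < Real.sin x / x by positivity)
    have e2 := sq_mul_abelFun_mul hq one_pos
    have hw : x / √3 * (Real.sin x / x) = Real.sin x / √3 := by field_simp
    have hq2 : (x / √3) ^ 2 = x ^ 2 / 3 := by rw [div_pow, Real.sq_sqrt (by norm_num)]
    rw [hw, hq2] at e1
    rw [mul_one, hq2] at e2
    have hW : (1 : ℝ) + (-1 / 2 * (x ^ 2 / 3) + 3 / 40 * (x ^ 2 / 3) ^ 2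
        + -3 / 560 * (x ^ 2 / 3) ^ 3 + 1 / 4480 * (x ^ 2 / 3) ^ 4
        + -27 / 4435200 * (x ^ 2 / 3) ^ 5 + (Real.sin x - (x - x ^ 3 / 6 + x ^ 5 / 120
          - x ^ 7 / 5040 + x ^ 9 / 362880 - x ^ 11 / 39916800)) * (729 / x ^ 13)
          * (x ^ 2 / 3) ^ 6) = Real.sin x / x := by
      field_simp
      ring
    have e3 : scaledAbel (x ^ 2 / 3) 1 = 1 + 79 / 350 * (x ^ 2 / 3) ^ 2
        + 87 / 875 * (x ^ 2 / 3) ^ 3 + 91543 / 1347500 * (x ^ 2 / 3) ^ 4 := by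
      simp [scaledAbel]
    rw [e3] at e2
    rw [hW, one_mul]
    have e4 : scaledAbel (x ^ 2 / 3) (Real.sin x / x)
        = x ^ 2 / 3 * abelFun (Real.sin x / √3) - 6 / 5 * (x ^ 2 / 3) * Real.log (x / √3) := by
      linear_combination -e1
    have e5 : abelFun (x / √3) = 3 / x ^ 2 * (1 + 79 / 350 * (x ^ 2 / 3) ^ 2
        + 87 / 875 * (x ^ 2 / 3) ^ 3 + 91543 / 1347500 * (x ^ 2 / 3) ^ 4
        + 6 / 5 * (x ^ 2 / 3) * Real.log (x / √3)) := by
      rw [← e2]; field_simp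
    rw [e4, e5]
    field_simp
    ring
  · refine IsBigO.of_bound (1 / 243) ?_
    filter_upwards [hpos] with x hx
    refine le_of_eq ?_
    rw [Real.norm_of_nonneg (by positivity), Real.norm_of_nonneg (by positivity)]
    field_simp
    norm_num

/-! ### Iterates of the sine -/

lemma sin_iterate_mem {a : ℝ} (ha : 0 < a) (ha' : a ≤ Real.pi / 2) (n : ℕ) :
    0 < Real.sin^[n] a ∧ Real.sin^[n] a ≤ Real.pi / 2 := by
  induction n with
  | zero => exact ⟨ha, ha'⟩
  | succ n ih =>
    rw [Function.iterate_succ_apply']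
    have hpi := Real.pi_gt_three
    exact ⟨Real.sin_pos_of_pos_of_lt_pi ih.1 (by linarith [ih.2]),
      (Real.sin_le_one _).trans (by linarith)⟩

lemma tendsto_sin_iterate {a : ℝ} (ha : 0 < a) (ha' : a ≤ Real.pi / 2) :
    Tendsto (fun n => Real.sin^[n] a) atTop (𝓝[>] 0) := by
  have hanti : Antitone fun n => Real.sin^[n] a := antitone_nat_of_succ_le fun n => by
    rw [Function.iterate_succ_apply']
    exact Real.sin_le (sin_iterate_mem ha ha' n).1.le
  have hbdd : BddBelow (Set.range fun n => Real.sin^[n] a) :=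
    ⟨0, by rintro _ ⟨n, rfl⟩; exact (sin_iterate_mem ha ha' n).1.le⟩
  have hlim := tendsto_atTop_ciInf hanti hbdd
  set L := ⨅ n, Real.sin^[n] a
  have hfix : Real.sin L = L := isFixedPt_of_tendsto_iterate hlim Real.continuous_sin.continuousAt
  have hL : 0 ≤ L := le_ciInf fun n => (sin_iterate_mem ha ha' n).1.le
  have hL0 : L = 0 := by
    by_contra h
    exact (Real.sin_lt (lt_of_le_of_ne hL (Ne.symm h))).ne hfix
  rw [hL0] at hlim
  exact tendsto_nhdsWithin_iff.2 ⟨hlim, Eventually.of_forall fun n => (sin_iterate_mem ha ha' n).1⟩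

/-- The Abel function is dominated by its pole at the origin. -/
lemma tendsto_sq_mul_abelFun : Tendsto (fun s => s ^ 2 * abelFun s) (𝓝[>] 0) (𝓝 1) := by
  have hlog : Tendsto (fun s : ℝ => Real.log s * s ^ 2) (𝓝[>] 0) (𝓝 0) := by
    simpa using tendsto_log_mul_rpow_nhdsGT_zero (r := 2) two_pos
  have hpoly : Tendsto (fun s : ℝ => 1 + 79 / 350 * s ^ 4 + 87 / 875 * s ^ 6
      + 91543 / 1347500 * s ^ 8) (𝓝[>] 0) (𝓝 1) := by
    have : Continuous fun s : ℝ => 1 + 79 / 350 * s ^ 4 + 87 / 875 * s ^ 6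
      + 91543 / 1347500 * s ^ 8 := by fun_prop
    simpa using (this.tendsto 0).mono_left nhdsWithin_le_nhds
  have h := hpoly.add (hlog.const_mul (6 / 5))
  rw [mul_zero, add_zero] at h
  refine h.congr' ?_
  filter_upwards [eventually_mem_nhdsWithin] with s hs
  have : s ≠ 0 := ne_of_gt hs
  unfold abelFun
  field_simp
  ring

/-- First-order asymptotics: the iterates are `√(3 / n)` to leading order. -/
lemma tendsto_nat_mul_sin_iterate_sq {a : ℝ} (ha : 0 < a) (ha' : a ≤ Real.pi / 2) :
    Tendsto (fun n : ℕ => n * (Real.sin^[n] a / √3) ^ 2) atTop (𝓝 1) := by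
  have hx := tendsto_sin_iterate ha ha'
  have hs : Tendsto (fun n => Real.sin^[n] a / √3) atTop (𝓝[>] 0) := by
    refine tendsto_nhdsWithin_iff.2 ⟨?_, Eventually.of_forall fun n =>
      div_pos (sin_iterate_mem ha ha' n).1 (by positivity)⟩
    simpa using (tendsto_nhdsWithin_iff.1 hx).1.div_const (√3)
  have hd : Tendsto (fun n => abelFun (Real.sin^[n + 1] a / √3) - abelFun (Real.sin^[n] a / √3))
      atTop (𝓝 1) := by
    have h10 : Tendsto (fun x : ℝ => x ^ 10) (𝓝[>] 0) (𝓝 0) := by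
      simpa using ((continuous_pow 10).tendsto (0 : ℝ)).mono_left nhdsWithin_le_nhds
    have h := ((abelFun_sin_sub_isBigO.trans_tendsto h10).comp hx).add_const 1
    rw [zero_add] at h
    refine h.congr fun n => ?_
    simp [Function.iterate_succ_apply']
  -- Averaging the increments gives `abelFun (xₙ / √3) / n → 1`.
  have hc := hd.cesaro
  simp only [Finset.sum_range_sub (fun n => abelFun (Real.sin^[n] a / √3))] at hc
  have hc' : Tendsto (fun n : ℕ => (n : ℝ)⁻¹ * abelFun (Real.sin^[n] a / √3)) atTop (𝓝 1) := by
    have h0 := (tendsto_inv_atTop_nhds_zero_nat (𝕜 := ℝ)).mul_const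
      (abelFun (Real.sin^[0] a / √3))
    have := hc.add h0
    rw [zero_mul, add_zero] at this
    exact this.congr fun n => by ring
  have h := (tendsto_sq_mul_abelFun.comp hs).div hc' one_ne_zero
  rw [div_one] at h
  refine h.congr' ?_
  filter_upwards [eventually_gt_atTop 0, hc'.eventually_ne one_ne_zero] with n hn hne
  have : abelFun (Real.sin^[n] a / √3) ≠ 0 := right_ne_zero_of_mul hne
  simp only [Function.comp_apply, Pi.div_apply]
  field_simp

/-- A sequence whose increments are `O(n ^ (-5))` converges, with error `O(n ^ (-4))`. -/
lemma exists_sub_isBigO_of_increment {D : ℕ → ℝ}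
    (h : (fun n => D (n + 1) - D n) =O[atTop] (fun n : ℕ => ((n : ℝ) ^ 5)⁻¹)) :
    ∃ c, (fun n => D n - c) =O[atTop] (fun n : ℕ => ((n : ℝ) ^ 4)⁻¹) := by
  obtain ⟨K, hK, hb⟩ := h.exists_pos
  obtain ⟨N, hN⟩ := eventually_atTop.1 hb.bound
  -- The bound on the increments telescopes, since `8 (n ^ (-4) - (n + 1) ^ (-4)) ≥ n ^ (-5)`.
  have hstep (n : ℕ) (hn : 1 ≤ n) :
      ((n : ℝ) ^ 5)⁻¹ ≤ 8 * (((n : ℝ) ^ 4)⁻¹ - (((n + 1 : ℕ) : ℝ) ^ 4)⁻¹) := by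
    have hn' : (1 : ℝ) ≤ n := by exact_mod_cast hn
    obtain ⟨m, hm, hnm⟩ : ∃ m : ℝ, 0 ≤ m ∧ (n : ℝ) = m + 1 := ⟨n - 1, by linarith, by ring⟩
    push_cast
    rw [hnm, ← sub_nonneg]
    have : 8 * (((m + 1) ^ 4)⁻¹ - ((m + 1 + 1) ^ 4)⁻¹) - ((m + 1) ^ 5)⁻¹
        = (8 * (m + 1) * ((m + 2) ^ 4 - (m + 1) ^ 4) - (m + 2) ^ 4)
          / ((m + 1) ^ 5 * (m + 2) ^ 4) := by
      field_simp
      ring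
    rw [this]
    apply div_nonneg _ (by positivity)
    ring_nf
    positivity
  have hdist (n : ℕ) (hn : max N 1 ≤ n) (m : ℕ) (hm : n ≤ m) :
      |D m - D n| ≤ K * (8 * (((n : ℝ) ^ 4)⁻¹ - ((m : ℝ) ^ 4)⁻¹)) := by
    induction m, hm using Nat.le_induction with
    | base => simp
    | succ m hm ih =>
      have h1 := hN m (((le_max_left _ _).trans hn).trans hm)
      rw [Real.norm_eq_abs, Real.norm_of_nonneg (by positivity)] at h1
      have h2 := mul_le_mul_of_nonneg_left
        (hstep m (((le_max_right _ _).trans hn).trans hm)) hK.le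
      calc |D (m + 1) - D n| ≤ |D (m + 1) - D m| + |D m - D n| := abs_sub_le _ _ _
        _ ≤ _ := by linarith
  have hdist' (n : ℕ) (hn : max N 1 ≤ n) (m : ℕ) (hm : n ≤ m) :
      |D m - D n| ≤ 8 * K * ((n : ℝ) ^ 4)⁻¹ := by
    have h1 := hdist n hn m hm
    have h2 : 0 ≤ K * ((m : ℝ) ^ 4)⁻¹ := by positivity
    linarith
  have hzero : Tendsto (fun n : ℕ => 8 * K * ((n : ℝ) ^ 4)⁻¹) atTop (𝓝 0) := by
    have := ((tendsto_inv_atTop_nhds_zero_nat (𝕜 := ℝ)).pow 4).const_mul (8 * K)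
    simpa using this
  have hcauchy : CauchySeq D := by
    rw [Metric.cauchySeq_iff']
    intro ε hε
    obtain ⟨M, hM, hM'⟩ := ((hzero.eventually_lt_const hε).and
      (eventually_ge_atTop (max N 1))).exists
    exact ⟨M, fun m hm => (hdist' M hM' m hm).trans_lt hM⟩
  obtain ⟨c, hc⟩ := cauchySeq_tendsto_of_complete hcauchy
  refine ⟨c, IsBigO.of_bound (8 * K) ?_⟩
  filter_upwards [eventually_ge_atTop (max N 1)] with n hn
  rw [Real.norm_of_nonneg (by positivity : (0 : ℝ) ≤ ((n : ℝ) ^ 4)⁻¹), norm_sub_rev]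
  refine le_of_tendsto ((hc.sub_const (D n)).norm) ?_
  filter_upwards [eventually_ge_atTop n] with m hm
  exact hdist' n hn m hm

/-- Along the iterates of the sine, the Abel function is `n` plus a constant, up to
`O(n ^ (-4))`; this is the constant of the expansion. -/
lemma exists_abelFun_sin_iterate {a : ℝ} (ha : 0 < a) (ha' : a ≤ Real.pi / 2) :
    ∃ c, (fun n : ℕ => abelFun (Real.sin^[n] a / √3) - n - c)
      =O[atTop] (fun n : ℕ => ((n : ℝ) ^ 4)⁻¹) := by
  apply exists_sub_isBigO_of_increment
  have h1 := abelFun_sin_sub_isBigO.comp_tendsto (tendsto_sin_iterate ha ha')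
  have h2 : (fun n : ℕ => (Real.sin^[n] a) ^ 10) =O[atTop] (fun n : ℕ => ((n : ℝ) ^ 5)⁻¹) := by
    have h3 := (((tendsto_nat_mul_sin_iterate_sq ha ha').isBigO_one ℝ).pow 5).mul
      (isBigO_refl (fun n : ℕ => 243 * ((n : ℝ) ^ 5)⁻¹) atTop)
    refine (h3.congr' ?_ (EventuallyEq.of_eq (funext fun n => by rw [one_pow, one_mul]))).trans
      (isBigO_const_mul_self 243 _ _)
    filter_upwards [eventually_gt_atTop 0] with n hn
    rw [div_pow, Real.sq_sqrt (by norm_num)]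
    field_simp
    norm_num
  refine IsBigO.congr_left (h1.trans h2) fun n => ?_
  simp only [Function.comp_apply, Function.iterate_succ_apply']
  push_cast
  ring

/-! ### The truncated expansion solves the Abel equation approximately -/

/-- Along `w = 1 + e₁ t + ⋯ + e₄ t ^ 4`, where `eᵢ t ^ i` collects the terms of the expansion of
relative order `n ^ (-i)` (here `t = log n / n` and `r = 1 / log n`), the rescaled Abel function
is `1 + 3 / 5 * t + c * r * t` up to `O(t ^ 5)`. -/
lemma scaledAbel_series_isBigO {α : Type*} {l : Filter α} {t r : α → ℝ} (c : ℝ)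
    (ht : Tendsto t l (𝓝 0)) (hr : r =O[l] (fun _ => (1 : ℝ))) :
    (fun a => scaledAbel (r a * t a) (1 + ((-3 / 10 - c / 2 * r a) * t a
      + (27 / 200 + (9 / 20 * c - 9 / 50) * r a
        + (3 / 8 * c ^ 2 - 3 / 10 * c + 79 / 700) * r a ^ 2) * t a ^ 2
      + (-27 / 400 - (27 / 80 * c - 27 / 125) * r a
        - (9 / 16 * c ^ 2 - 18 / 25 * c + 1941 / 7000) * r a ^ 2
        - (5 / 16 * c ^ 3 - 3 / 5 * c ^ 2 + 647 / 1400 * c - 411 / 3500) * r a ^ 3) * t a ^ 3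
      + (567 / 16000 + (189 / 800 * c - 1917 / 10000) * r a
        + (189 / 320 * c ^ 2 - 1917 / 2000 * c + 1683 / 4000) * r a ^ 2
        + (21 / 32 * c ^ 3 - 639 / 400 * c ^ 2 + 561 / 400 * c - 7227 / 17500) * r a ^ 3
        + (35 / 128 * c ^ 4 - 71 / 80 * c ^ 3 + 187 / 160 * c ^ 2 - 2409 / 3500 * c
          + 1606257 / 10780000) * r a ^ 4) * t a ^ 4))
      - (1 + 3 / 5 * t a + c * (r a * t a))) =O[l] (fun a => t a ^ 5) := by
  obtain ⟨e₁, q₁⟩ : ∃ f : ℝ → ℝ, ∀ x, f x = -3 / 10 - c / 2 * x := ⟨_, fun _ => rfl⟩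
  obtain ⟨e₂, q₂⟩ : ∃ f : ℝ → ℝ, ∀ x, f x = 27 / 200 + (9 / 20 * c - 9 / 50) * x
      + (3 / 8 * c ^ 2 - 3 / 10 * c + 79 / 700) * x ^ 2 := ⟨_, fun _ => rfl⟩
  obtain ⟨e₃, q₃⟩ : ∃ f : ℝ → ℝ, ∀ x, f x = -27 / 400 - (27 / 80 * c - 27 / 125) * x
      - (9 / 16 * c ^ 2 - 18 / 25 * c + 1941 / 7000) * x ^ 2
      - (5 / 16 * c ^ 3 - 3 / 5 * c ^ 2 + 647 / 1400 * c - 411 / 3500) * x ^ 3 :=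
    ⟨_, fun _ => rfl⟩
  obtain ⟨e₄, q₄⟩ : ∃ f : ℝ → ℝ, ∀ x, f x = 567 / 16000 + (189 / 800 * c - 1917 / 10000) * x
      + (189 / 320 * c ^ 2 - 1917 / 2000 * c + 1683 / 4000) * x ^ 2
      + (21 / 32 * c ^ 3 - 639 / 400 * c ^ 2 + 561 / 400 * c - 7227 / 17500) * x ^ 3
      + (35 / 128 * c ^ 4 - 71 / 80 * c ^ 3 + 187 / 160 * c ^ 2 - 2409 / 3500 * c
        + 1606257 / 10780000) * x ^ 4 := ⟨_, fun _ => rfl⟩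
  simp only [← q₁, ← q₂, ← q₃, ← q₄]
  have c₁ : Continuous e₁ := by rw [funext q₁]; fun_prop
  have c₂ : Continuous e₂ := by rw [funext q₂]; fun_prop
  have c₃ : Continuous e₃ := by rw [funext q₃]; fun_prop
  have c₄ : Continuous e₄ := by rw [funext q₄]; fun_prop
  have hzero : (fun _ : α => (0 : ℝ)) =O[l] (fun _ => (1 : ℝ)) := isBigO_zero _ _
  have h := (scaledAbel_expansion ht hr (c₁.comp_isBigO_one hr) (c₂.comp_isBigO_one hr)
    (c₃.comp_isBigO_one hr) (c₄.comp_isBigO_one hr) hzero hzero).trans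
    (((isBigO_refl (fun a => t a ^ 5) l).mul (ht.isBigO_one ℝ)).congr
      (fun a => (pow_succ (t a) 5).symm) fun a => mul_one _)
  have h5 : Continuous fun r : ℝ => -2 * 0 + 6 * e₁ r * e₄ r + 6 * e₂ r * e₃ r
      - 12 * e₁ r ^ 2 * e₃ r - 12 * e₁ r * e₂ r ^ 2 + 20 * e₁ r ^ 3 * e₂ r - 6 * e₁ r ^ 5
      + 6 / 5 * r * (e₄ r - e₁ r * e₃ r - e₂ r ^ 2 / 2 + e₁ r ^ 2 * e₂ r - e₁ r ^ 4 / 4)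
      + 79 / 350 * r ^ 2 * (2 * e₃ r + 2 * e₁ r * e₂ r)
      + 87 / 875 * r ^ 3 * (4 * e₂ r + 6 * e₁ r ^ 2)
      + 91543 / 1347500 * r ^ 4 * (6 * e₁ r) := by fun_prop
  have h5' := (h5.comp_isBigO_one hr).mul (isBigO_refl (fun a => t a ^ 5) l)
  simp only [one_mul] at h5'
  refine (h.add h5').congr_left fun a => ?_
  -- The coefficients of `t ^ 2`, `t ^ 3` and `t ^ 4` vanish: this determines the expansion.
  have g₁ : -2 * e₁ (r a) = 3 / 5 + c * r a := by rw [q₁]; ring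
  have g₂ : -2 * e₂ (r a) + 3 * e₁ (r a) ^ 2 + 6 / 5 * r a * e₁ (r a) + 79 / 350 * r a ^ 2 = 0 := by
    rw [q₁, q₂]; ring
  have g₃ : -2 * e₃ (r a) + 6 * e₁ (r a) * e₂ (r a) - 4 * e₁ (r a) ^ 3
      + 6 / 5 * r a * (e₂ (r a) - e₁ (r a) ^ 2 / 2)
      + 79 / 350 * r a ^ 2 * (2 * e₁ (r a)) + 87 / 875 * r a ^ 3 = 0 := by
    rw [q₁, q₂, q₃]; ring
  have g₄ : -2 * e₄ (r a) + 6 * e₁ (r a) * e₃ (r a) + 3 * e₂ (r a) ^ 2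
      - 12 * e₁ (r a) ^ 2 * e₂ (r a) + 5 * e₁ (r a) ^ 4
      + 6 / 5 * r a * (e₃ (r a) - e₁ (r a) * e₂ (r a) + e₁ (r a) ^ 3 / 3)
      + 79 / 350 * r a ^ 2 * (2 * e₂ (r a) + e₁ (r a) ^ 2) + 87 / 875 * r a ^ 3 * (4 * e₁ (r a))
      + 91543 / 1347500 * r a ^ 4 = 0 := by
    rw [q₁, q₂, q₃, q₄]; ring
  rw [g₂, g₃, g₄]
  simp only [zero_mul, add_zero]
  linear_combination (-t a) * g₁

/-- Since `∂ scaledAbel / ∂ w = -2` at `(0, 1)`, two arguments near `1` are as close as their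
images. -/
lemma sub_isBigO_scaledAbel_sub {α : Type*} {l : Filter α} {v w w' : α → ℝ}
    (hv : Tendsto v l (𝓝 0)) (hw : Tendsto w l (𝓝 1)) (hw' : Tendsto w' l (𝓝 1)) :
    (fun a => w a - w' a) =O[l] (fun a => scaledAbel (v a) (w a) - scaledAbel (v a) (w' a)) := by
  set f : ℝ × ℝ → ℝ := fun p => scaledAbel p.1 p.2 with hf
  have hdiff : ContDiffAt ℝ 1 f (0, 1) := by
    have h1 : ContDiffAt ℝ 1 (fun p : ℝ × ℝ => 1 / p.2 ^ 2) (0, 1) :=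
      contDiffAt_const.div (contDiffAt_snd.pow 2) (by norm_num)
    have h2 : ContDiffAt ℝ 1 (fun p : ℝ × ℝ => Real.log p.2) (0, 1) :=
      contDiffAt_snd.log (by norm_num)
    simp only [hf, scaledAbel]
    fun_prop
  have hstrict := hdiff.hasStrictFDerivAt one_ne_zero
  have hder : fderiv ℝ f (0, 1) (0, 1) = -2 := by
    have h1 : HasDerivAt (fun w : ℝ => ((0 : ℝ), w)) (0, 1) 1 :=
      (hasDerivAt_const _ _).prodMk (hasDerivAt_id _)
    have h2 := hstrict.hasFDerivAt.comp_hasDerivAt (1 : ℝ) h1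
    have h3 : HasDerivAt (fun w : ℝ => w⁻¹ ^ 2) (-2) 1 := by
      have := ((hasDerivAt_inv (one_ne_zero (α := ℝ))).pow 2)
      norm_num at this
      exact this
    refine h2.unique (h3.congr_of_eventuallyEq (Eventually.of_forall fun w => ?_))
    simp [f, scaledAbel]
  have hp : Tendsto (fun a => ((v a, w a), (v a, w' a))) l (𝓝 ((0, 1), (0, 1))) :=
    (hv.prodMk_nhds hw).prodMk_nhds (hv.prodMk_nhds hw')
  have h := hstrict.isLittleO.comp_tendsto hp
  have h' : (fun a => scaledAbel (v a) (w a) - scaledAbel (v a) (w' a) + 2 * (w a - w' a))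
      =o[l] (fun a => w a - w' a) := by
    refine (h.trans_isBigO (IsBigO.of_bound 1 (Eventually.of_forall fun a => ?_))).congr_left
      fun a => ?_
    · simp
    · have : ((v a, w a) - (v a, w' a) : ℝ × ℝ) = (w a - w' a) • (0, 1) := by simp
      simp only [Function.comp_apply, this, map_smul, hder, f]
      simp only [smul_eq_mul]
      ring
  have h2 := h'.const_mul_left (1 / 2)
  refine IsBigO.trans ?_ ((isBigO_refl _ l).const_mul_left (-1 / 2 : ℝ))
  refine (h2.right_isBigO_sub).congr_right fun a => ?_
  ring

/-! ### Comparison of the iterates with the expansion -/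

/-- The expansion is `n ^ (-1/2)` times the series of `scaledAbel_series_isBigO` at
`t = log n / n`, `r = 1 / log n`. -/
lemma sineExpansion_eq (c : ℝ) {n : ℕ} (hn : 2 ≤ n) :
    sineExpansion c n = 1 / (n : ℝ) ^ (1 / 2 : ℝ) *
      (1 + ((-3 / 10 - c / 2 * (Real.log n)⁻¹) * (Real.log n / n)
      + (27 / 200 + (9 / 20 * c - 9 / 50) * (Real.log n)⁻¹
        + (3 / 8 * c ^ 2 - 3 / 10 * c + 79 / 700) * (Real.log n)⁻¹ ^ 2) * (Real.log n / n) ^ 2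
      + (-27 / 400 - (27 / 80 * c - 27 / 125) * (Real.log n)⁻¹
        - (9 / 16 * c ^ 2 - 18 / 25 * c + 1941 / 7000) * (Real.log n)⁻¹ ^ 2
        - (5 / 16 * c ^ 3 - 3 / 5 * c ^ 2 + 647 / 1400 * c - 411 / 3500) * (Real.log n)⁻¹ ^ 3)
          * (Real.log n / n) ^ 3
      + (567 / 16000 + (189 / 800 * c - 1917 / 10000) * (Real.log n)⁻¹
        + (189 / 320 * c ^ 2 - 1917 / 2000 * c + 1683 / 4000) * (Real.log n)⁻¹ ^ 2
        + (21 / 32 * c ^ 3 - 639 / 400 * c ^ 2 + 561 / 400 * c - 7227 / 17500)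
          * (Real.log n)⁻¹ ^ 3
        + (35 / 128 * c ^ 4 - 71 / 80 * c ^ 3 + 187 / 160 * c ^ 2 - 2409 / 3500 * c
          + 1606257 / 10780000) * (Real.log n)⁻¹ ^ 4) * (Real.log n / n) ^ 4)) := by
  have hn0 : (0 : ℝ) < n := by positivity
  have hlog : Real.log n ≠ 0 := (Real.log_pos (by exact_mod_cast hn)).ne'
  have hq : (0 : ℝ) < (n : ℝ) ^ (1 / 2 : ℝ) := by positivity
  have hpow (k : ℕ) (x : ℝ) (hx : x = 1 / 2 + k) :
      (n : ℝ) ^ x = (n : ℝ) ^ (1 / 2 : ℝ) * n ^ k := by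
    rw [hx, Real.rpow_add hn0, Real.rpow_natCast]
  unfold sineExpansion
  rw [hpow 1 (3 / 2) (by norm_num), hpow 2 (5 / 2) (by norm_num), hpow 3 (7 / 2) (by norm_num),
    hpow 4 (9 / 2) (by norm_num)]
  generalize (n : ℝ) ^ (1 / 2 : ℝ) = q at *
  generalize Real.log n = ℓ at *
  field_simp
  ring

/-- After multiplication by `√n`, the iterates and the expansion have the same image under the
rescaled Abel function up to `O((log n / n) ^ 5)`, hence agree to that order. -/
lemma sin_iterate_sub_sineExpansion_isBigO {a : ℝ} (ha : 0 < a) (ha' : a ≤ Real.pi / 2) :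
    ∃ c, (fun n : ℕ => Real.sin^[n] a / √3 - sineExpansion c n)
      =O[atTop] (fun n : ℕ => Real.log n ^ 5 / (n : ℝ) ^ (11 / 2 : ℝ)) := by
  obtain ⟨c, hc⟩ := exists_abelFun_sin_iterate ha ha'
  refine ⟨c, ?_⟩
  have hlogtop : Tendsto (fun n : ℕ => Real.log n) atTop atTop :=
    Real.tendsto_log_atTop.comp tendsto_natCast_atTop_atTop
  have hr : Tendsto (fun n : ℕ => (Real.log n)⁻¹) atTop (𝓝 0) := hlogtop.inv_tendsto_atTop
  have ht : Tendsto (fun n : ℕ => Real.log n / n) atTop (𝓝 0) :=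
    (Real.isLittleO_log_id_atTop.tendsto_div_nhds_zero).comp tendsto_natCast_atTop_atTop
  have hv : Tendsto (fun n : ℕ => (n : ℝ)⁻¹) atTop (𝓝 0) := tendsto_inv_atTop_nhds_zero_nat
  have hrt : ∀ᶠ n : ℕ in atTop, (Real.log n)⁻¹ * (Real.log n / n) = (n : ℝ)⁻¹ := by
    filter_upwards [eventually_ge_atTop 2] with n hn
    have hlog : Real.log n ≠ 0 := (Real.log_pos (by exact_mod_cast hn)).ne'
    field_simp
  have hvt : (fun n : ℕ => (n : ℝ)⁻¹) =O[atTop] (fun n : ℕ => Real.log n / n) := by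
    refine ((hr.isBigO_one ℝ).mul (isBigO_refl (fun n : ℕ => Real.log n / n) atTop)).congr' hrt ?_
    exact Eventually.of_forall fun n => one_mul _
  have hseries := scaledAbel_series_isBigO c ht (hr.isBigO_one ℝ)
  obtain ⟨U, hU⟩ : ∃ U : ℝ → ℝ → ℝ, ∀ r t, U r t = 1 + ((-3 / 10 - c / 2 * r) * t
      + (27 / 200 + (9 / 20 * c - 9 / 50) * r
        + (3 / 8 * c ^ 2 - 3 / 10 * c + 79 / 700) * r ^ 2) * t ^ 2
      + (-27 / 400 - (27 / 80 * c - 27 / 125) * r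
        - (9 / 16 * c ^ 2 - 18 / 25 * c + 1941 / 7000) * r ^ 2
        - (5 / 16 * c ^ 3 - 3 / 5 * c ^ 2 + 647 / 1400 * c - 411 / 3500) * r ^ 3) * t ^ 3
      + (567 / 16000 + (189 / 800 * c - 1917 / 10000) * r
        + (189 / 320 * c ^ 2 - 1917 / 2000 * c + 1683 / 4000) * r ^ 2
        + (21 / 32 * c ^ 3 - 639 / 400 * c ^ 2 + 561 / 400 * c - 7227 / 17500) * r ^ 3
        + (35 / 128 * c ^ 4 - 71 / 80 * c ^ 3 + 187 / 160 * c ^ 2 - 2409 / 3500 * c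
          + 1606257 / 10780000) * r ^ 4) * t ^ 4) := ⟨_, fun _ _ => rfl⟩
  simp only [← hU] at hseries
  have hUlim : Tendsto (fun n : ℕ => U (Real.log n)⁻¹ (Real.log n / n)) atTop (𝓝 1) := by
    have hcont : Continuous fun p : ℝ × ℝ => U p.1 p.2 := by simp only [hU]; fun_prop
    have h := (hcont.tendsto (0, 0)).comp (hr.prodMk_nhds ht)
    have h0 : U 0 0 = 1 := by rw [hU]; norm_num
    rw [h0] at h
    exact h
  -- The iterates in the same scale: `A = √n * x / √3`.
  obtain ⟨A, hA⟩ : ∃ A : ℕ → ℝ, ∀ n, A n = √n * (Real.sin^[n] a / √3) := ⟨_, fun _ => rfl⟩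
  have hAlim : Tendsto A atTop (𝓝 1) := by
    have h := (Real.continuous_sqrt.tendsto 1).comp (tendsto_nat_mul_sin_iterate_sq ha ha')
    rw [Real.sqrt_one] at h
    refine h.congr fun n => ?_
    have : 0 ≤ Real.sin^[n] a / √3 := div_nonneg (sin_iterate_mem ha ha' n).1.le (by positivity)
    rw [hA, Function.comp_apply, Real.sqrt_mul (by positivity), Real.sqrt_sq this]
  have hAabel : (fun n : ℕ => scaledAbel ((n : ℝ)⁻¹) (A n)
      - (1 + 3 / 5 * (Real.log n / n) + c * (n : ℝ)⁻¹))
      =O[atTop] (fun n : ℕ => (Real.log n / n) ^ 5) := by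
    refine IsBigO.trans ?_ (hvt.pow 5)
    refine ((isBigO_refl (fun n : ℕ => (n : ℝ)⁻¹) atTop).mul hc).congr' ?_ ?_
    · filter_upwards [eventually_gt_atTop 0] with n hn
      have hn0 : (0 : ℝ) < n := by exact_mod_cast hn
      have hx := (sin_iterate_mem ha ha' n).1
      have h := sq_mul_abelFun_mul (q := (√n)⁻¹) (w := A n) (by positivity)
        (by rw [hA]; positivity)
      have hqA : (√n)⁻¹ * A n = Real.sin^[n] a / √3 := by
        rw [hA]; field_simp
      rw [hqA, inv_pow, Real.sq_sqrt hn0.le, Real.log_inv, Real.log_sqrt hn0.le] at h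
      have hnn : (n : ℝ)⁻¹ * n = 1 := inv_mul_cancel₀ hn0.ne'
      rw [div_eq_mul_inv (Real.log n)]
      linear_combination h - hnn
    · exact Eventually.of_forall fun n => by
        dsimp only
        rw [← mul_inv, ← pow_succ', inv_pow]
  have hdiff : (fun n : ℕ => A n - U (Real.log n)⁻¹ (Real.log n / n))
      =O[atTop] (fun n : ℕ => (Real.log n / n) ^ 5) := by
    refine (sub_isBigO_scaledAbel_sub hv hAlim hUlim).trans ?_
    refine (hAabel.sub hseries).congr' ?_ EventuallyEq.rfl
    filter_upwards [hrt] with n hn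
    rw [hn]
    ring
  refine ((isBigO_refl (fun n : ℕ => 1 / (n : ℝ) ^ (1 / 2 : ℝ)) atTop).mul hdiff).congr' ?_ ?_
  · filter_upwards [eventually_ge_atTop 2] with n hn
    have hn0 : (0 : ℝ) < n := by positivity
    rw [sineExpansion_eq c hn, ← hU, hA, Real.sqrt_eq_rpow, mul_sub]
    have : (n : ℝ) ^ (1 / 2 : ℝ) ≠ 0 := by positivity
    field_simp
  · filter_upwards [eventually_gt_atTop 0] with n hn
    have hn0 : (0 : ℝ) < n := by exact_mod_cast hn
    rw [show (11 / 2 : ℝ) = 1 / 2 + (5 : ℕ) by norm_num, Real.rpow_add hn0, Real.rpow_natCast]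
    field_simp

theorem mainTheorem1 :
    ∃ C : ℝ → ℝ, ∀ x : ℕ → ℝ, 0 < x 0 → x 0 ≤ Real.pi / 2 →
      (∀ n : ℕ, 1 ≤ n → x n = Real.sin (x (n - 1))) →
      (fun n : ℕ => x n / Real.sqrt 3 - sineExpansion (C (x 0)) n)
        =O[atTop] (fun n : ℕ => Real.log n ^ 5 / (n : ℝ) ^ (11 / 2 : ℝ)) := by
  -- Iterates depend only on the starting value; outside `(0, π / 2]` the constant is arbitrary.
  have hex (a : ℝ) : ∃ c, 0 < a → a ≤ Real.pi / 2 →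
      (fun n : ℕ => Real.sin^[n] a / √3 - sineExpansion c n)
        =O[atTop] (fun n : ℕ => Real.log n ^ 5 / (n : ℝ) ^ (11 / 2 : ℝ)) := by
    by_cases h : 0 < a ∧ a ≤ Real.pi / 2
    · obtain ⟨c, hc⟩ := sin_iterate_sub_sineExpansion_isBigO h.1 h.2
      exact ⟨c, fun _ _ => hc⟩
    · exact ⟨0, fun h1 h2 => absurd ⟨h1, h2⟩ h⟩
  choose C hC using hex
  refine ⟨C, fun x h0 hpi hx => ?_⟩
  have hiter (n : ℕ) : x n = Real.sin^[n] (x 0) := by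
    induction n with
    | zero => rfl
    | succ n ih =>
      rw [Function.iterate_succ_apply', ← ih]
      exact hx (n + 1) (Nat.le_add_left 1 n)
  exact (hC (x 0) h0 hpi).congr_left fun n => by rw [hiter n]
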